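/- Let $(\bar M,\bar g)$ be an $(n+2)$-dimensional Lorentzian manifold with Levi-Civita connection $\bar\nabla$, and let $(M,g,S(TM))$ be a null hypersurface of it: $M$ is an $(n+1)$-manifold immersed in $\bar M$ whose induced metric $g$ is degenerate at every point, and $S(TM)$ is a screen distribution, that is, a smooth subbundle of $TM$ with $TM=S(TM)\oplus \mathrm{rad}(TM)$, where $\mathrm{rad}(T_pM)=T_pM\cap T_pM^{\perp}$. Let $\mathrm{tr}(TM)$ be the transversal line bundle spanned by the vectors $N$ with $\bar g(N,N)=0$, $\bar g(N,X)=0$ for all $X\in S(TM)$ and $\bar g(\xi,N)=1$ for some $\xi\in\mathrm{rad}(TM)$, so that $T\bar M|_M=TM\oplus\mathrm{tr}(TM)=S(TM)\oplus\mathrm{rad}(TM)\oplus\mathrm{tr}(TM)$. The induced connection $\nabla_XY$ ($X,Y\in\Gamma(TM)$) is the $TM$-component of $\bar\nabla_XY$, and the screen connection $\overset{*}{\nabla}_XY$ ($Y\in\Gamma(S(TM))$) is the $S(TM)$-component of $\nabla_XY$. For a vector field $Z$ along $M$ let $\overset{*}{Z}$ be its $S(TM)$-component and $Z^\perp=Z-\overset{*}{Z}\in\Gamma(S(TM)^\perp)$,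 where $S(TM)^\perp=\mathrm{rad}(TM)\oplus\mathrm{tr}(TM)$. Let $A_{Z^\perp}$ be the shape operator of $S(TM)$ in the direction $Z^\perp$: $-A_{Z^\perp}X$ is the $S(TM)$-component of $\bar\nabla_XZ^\perp$. Assume that the distribution $S(TM)$ is integrable, that $Z$ is a closed conformal vector field along $M$, i.e. $Z$ is smooth and $\bar\nabla_XZ=\varphi X$ for all $X$ tangent to $M$, with $\varphi:M\to\mathbb R$ a smooth function (for instance the restriction to $M$ of a closed conformal vector field of $\bar M$), and that $Z$ is a canonical principal direction with respect to $A_{Z^\perp}$, i.e. at each point $\overset{*}{Z}\neq 0$ is an eigenvector of $A_{Z^\perp}$. Let $T=\overset{*}{Z}/|\overset{*}{Z}|$, where $|\overset{*}{Z}|=\sqrt{g(\overset{*}{Z},\overset{*}{Z})}$. Then: 1. $T$ is a geodesic vector field on $S(TM)$: it is a smooth section of $S(TM)$ with $\overset{*}{\nabla}_TT=0$. 2. At each point $T$ is an eigenvector of $A_{Z^\perp}$, and its eigenvalue is $\lambda=g(\overset{*}{\nabla}_T\overset{*}{Z},T)-\varphi$. -/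

import Mathlib

open scoped Manifold ContDiff

noncomputable section

open Bundle VectorField
open scoped Topology

set_option linter.unusedSectionVars false

/-- A Lorentzian metric on `M`: a smooth field of symmetric bilinear forms on the tangent spaces,
each of which is negative on some vector `t` and positive definite on the orthogonal complement of
`t` (so that it has signature `(-, +, ..., +)`). -/
structure LorentzianMetric {E : Type*} [NormedAddCommGroup E] [NormedSpace ℝ E]
    {H : Type*} [TopologicalSpace H] (I : ModelWithCorners ℝ E H)
    (M : Type*) [TopologicalSpace M] [ChartedSpace H M] [IsManifold I ∞ M] where
  val (x : M) : TangentSpace I x →L[ℝ] TangentSpace I x →L[ℝ] ℝ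
  symm (x : M) (v w : TangentSpace I x) : val x v w = val x w v
  contMDiff : ContMDiff I (I.prod 𝓘(ℝ, E →L[ℝ] E →L[ℝ] ℝ)) ∞
    (fun x ↦ TotalSpace.mk' (E →L[ℝ] E →L[ℝ] ℝ)
      (E := fun x : M ↦ TangentSpace I x →L[ℝ] TangentSpace I x →L[ℝ] ℝ) x (val x))
  exists_timelike (x : M) : ∃ t : TangentSpace I x, val x t t < 0 ∧
    ∀ v : TangentSpace I x, val x t v = 0 → v ≠ 0 → 0 < val x v v

namespace LorentzianMetric

section Koszul

variable {E : Type*} [NormedAddCommGroup E] [NormedSpace ℝ E]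
    {H : Type*} [TopologicalSpace H] {I : ModelWithCorners ℝ E H}
    {M : Type*} [TopologicalSpace M] [ChartedSpace H M] [IsManifold I ∞ M]
    (g : LorentzianMetric I M)

theorem eq_zero_of_forall {x : M} {v : TangentSpace I x} (h : ∀ w, g.val x v w = 0) : v = 0 := by
  obtain ⟨t, ht, hpos⟩ := g.exists_timelike x
  by_contra hv
  have := hpos v (by rw [g.symm]; exact h t) hv
  simp [h v] at this

/-- Koszul's expression for `2 g(∇_X Y, W)`. -/
def koszul (X Y W : Π x : M, TangentSpace I x) (x : M) : ℝ :=
  mvfderiv I (fun y ↦ g.val y (Y y) (W y)) x (X x)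
    + mvfderiv I (fun y ↦ g.val y (X y) (W y)) x (Y x)
    - mvfderiv I (fun y ↦ g.val y (X y) (Y y)) x (W x)
    + g.val x (mlieBracket I X Y x) (W x)
    - g.val x (mlieBracket I X W x) (Y x)
    - g.val x (mlieBracket I Y W x) (X x)

variable {x : M} {X X' Y Y' W W' : Π x : M, TangentSpace I x}

theorem mdifferentiableAt_val (hX : MDiffAt (T% X) x) (hY : MDiffAt (T% Y) x) :
    MDiffAt (fun y ↦ g.val y (X y) (Y y)) x := by
  have h := MDifferentiableAt.clm_bundle_apply₂ (F₁ := E) (F₂ := E) (F₃ := ℝ)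
    (E₃ := Bundle.Trivial M ℝ)
    (g.contMDiff.mdifferentiableAt (x := x) (by simp)) hX hY
  rw [mdifferentiableAt_totalSpace] at h
  simpa using h.2

theorem mvfderiv_smul_left {f : M → ℝ} (hf : MDiffAt f x) (hX : MDiffAt (T% X) x)
    (hY : MDiffAt (T% Y) x) (v : TangentSpace I x) :
    mvfderiv I (fun y ↦ g.val y ((f • X) y) (Y y)) x v =
      f x * mvfderiv I (fun y ↦ g.val y (X y) (Y y)) x v
        + mvfderiv I f x v * g.val x (X x) (Y x) := by
  have : (fun y ↦ g.val y ((f • X) y) (Y y)) = f * fun y ↦ g.val y (X y) (Y y) := by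
    ext y; simp
  rw [this, mvfderiv_mul hf (g.mdifferentiableAt_val hX hY)]
  simp [mul_comm]

theorem mvfderiv_add_left (hX : MDiffAt (T% X) x) (hX' : MDiffAt (T% X') x)
    (hY : MDiffAt (T% Y) x) (v : TangentSpace I x) :
    mvfderiv I (fun y ↦ g.val y ((X + X') y) (Y y)) x v =
      mvfderiv I (fun y ↦ g.val y (X y) (Y y)) x v
        + mvfderiv I (fun y ↦ g.val y (X' y) (Y y)) x v := by
  have : (fun y ↦ g.val y ((X + X') y) (Y y)) =
      (fun y ↦ g.val y (X y) (Y y)) + fun y ↦ g.val y (X' y) (Y y) := by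
    ext y; simp
  rw [this, mvfderiv_add (g.mdifferentiableAt_val hX hY) (g.mdifferentiableAt_val hX' hY)]
  simp

theorem val_comm_fun (X Y : Π x : M, TangentSpace I x) :
    (fun y ↦ g.val y (X y) (Y y)) = fun y ↦ g.val y (Y y) (X y) := by
  ext y; exact g.symm _ _ _

variable [CompleteSpace E]

theorem koszul_smul_left {f : M → ℝ} (hf : MDiffAt f x) (hX : MDiffAt (T% X) x)
    (hY : MDiffAt (T% Y) x) (hW : MDiffAt (T% W) x) :
    g.koszul (f • X) Y W x = f x * g.koszul X Y W x := by
  simp only [koszul, g.mvfderiv_smul_left hf hX hY, g.mvfderiv_smul_left hf hX hW,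
    mlieBracket_smul_left hf hX]
  simp only [Pi.smul_apply', map_add, map_smul, add_apply, smul_apply, smul_eq_mul]
  rw [g.symm x (X x) (Y x)]
  ring

theorem koszul_add_left (hX : MDiffAt (T% X) x) (hX' : MDiffAt (T% X') x)
    (hY : MDiffAt (T% Y) x) (hW : MDiffAt (T% W) x) :
    g.koszul (X + X') Y W x = g.koszul X Y W x + g.koszul X' Y W x := by
  simp only [koszul, g.mvfderiv_add_left hX hX' hY, g.mvfderiv_add_left hX hX' hW,
    mlieBracket_add_left hX hX']
  simp only [Pi.add_apply, map_add, add_apply]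
  ring

theorem koszul_sub_swap : g.koszul X Y W x - g.koszul Y X W x =
    2 * g.val x (mlieBracket I X Y x) (W x) := by
  simp only [koszul, g.val_comm_fun Y X, mlieBracket_swap_apply (V := Y) (W := X), map_neg,
    neg_apply]
  ring

theorem koszul_add_swap : g.koszul X Y W x + g.koszul X W Y x =
    2 * mvfderiv I (fun y ↦ g.val y (Y y) (W y)) x (X x) := by
  simp only [koszul, g.val_comm_fun W Y, mlieBracket_swap_apply (V := W) (W := Y), map_neg,
    neg_apply]
  ring

theorem koszul_smul_middle {f : M → ℝ} (hf : MDiffAt f x) (hX : MDiffAt (T% X) x)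
    (hY : MDiffAt (T% Y) x) (hW : MDiffAt (T% W) x) :
    g.koszul X (f • Y) W x =
      f x * g.koszul X Y W x + 2 * (mvfderiv I f x (X x) * g.val x (Y x) (W x)) := by
  have h₁ := g.koszul_sub_swap (X := X) (Y := f • Y) (W := W) (x := x)
  have h₂ := g.koszul_sub_swap (X := X) (Y := Y) (W := W) (x := x)
  rw [g.koszul_smul_left hf hY hX hW, mlieBracket_smul_right hf hY] at h₁
  simp only [map_add, map_smul, add_apply, smul_apply, smul_eq_mul] at h₁
  linear_combination h₁ - f x * h₂

theorem koszul_add_middle (hX : MDiffAt (T% X) x) (hY : MDiffAt (T% Y) x)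
    (hY' : MDiffAt (T% Y') x) (hW : MDiffAt (T% W) x) :
    g.koszul X (Y + Y') W x = g.koszul X Y W x + g.koszul X Y' W x := by
  have h₁ := g.koszul_sub_swap (X := X) (Y := Y + Y') (W := W) (x := x)
  have h₂ := g.koszul_sub_swap (X := X) (Y := Y) (W := W) (x := x)
  have h₃ := g.koszul_sub_swap (X := X) (Y := Y') (W := W) (x := x)
  rw [g.koszul_add_left hY hY' hX hW, mlieBracket_add_right hY hY'] at h₁
  simp only [map_add, add_apply] at h₁
  linear_combination h₁ - h₂ - h₃

theorem koszul_smul_right {f : M → ℝ} (hf : MDiffAt f x) (hX : MDiffAt (T% X) x)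
    (hY : MDiffAt (T% Y) x) (hW : MDiffAt (T% W) x) :
    g.koszul X Y (f • W) x = f x * g.koszul X Y W x := by
  have h₁ := g.koszul_add_swap (X := X) (Y := f • W) (W := Y) (x := x)
  have h₂ := g.koszul_add_swap (X := X) (Y := W) (W := Y) (x := x)
  rw [g.koszul_smul_middle hf hX hW hY, g.mvfderiv_smul_left hf hW hY] at h₁
  linear_combination h₁ - f x * h₂

theorem koszul_add_right (hX : MDiffAt (T% X) x) (hY : MDiffAt (T% Y) x)
    (hW : MDiffAt (T% W) x) (hW' : MDiffAt (T% W') x) :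
    g.koszul X Y (W + W') x = g.koszul X Y W x + g.koszul X Y W' x := by
  have h₁ := g.koszul_add_swap (X := X) (Y := W + W') (W := Y) (x := x)
  have h₂ := g.koszul_add_swap (X := X) (Y := W) (W := Y) (x := x)
  have h₃ := g.koszul_add_swap (X := X) (Y := W') (W := Y) (x := x)
  rw [g.koszul_add_middle hX hW hW' hY, g.mvfderiv_add_left hW hW' hY] at h₁
  linear_combination h₁ - h₂ - h₃

theorem tensorialAt_koszul_left (hY : MDiffAt (T% Y) x) (hW : MDiffAt (T% W) x) :
    TensorialAt I E (fun X ↦ g.koszul X Y W x) x where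
  smul hf hX := g.koszul_smul_left hf hX hY hW
  add hX hX' := g.koszul_add_left hX hX' hY hW

theorem tensorialAt_koszul_right (hX : MDiffAt (T% X) x) (hY : MDiffAt (T% Y) x) :
    TensorialAt I E (fun W ↦ g.koszul X Y W x) x where
  smul hf hW := g.koszul_smul_right hf hX hY hW
  add hW hW' := g.koszul_add_right hX hY hW hW'

variable [FiniteDimensional ℝ E]

/-- The metric as a bilinear form on each tangent space. -/
def bilin (x : M) : LinearMap.BilinForm ℝ (TangentSpace I x) :=
  (ContinuousLinearMap.coeLM ℝ).comp (g.val x).toLinearMap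

theorem nondegenerate_bilin (x : M) : (g.bilin x).Nondegenerate :=
  ⟨fun _ hv ↦ g.eq_zero_of_forall hv,
    fun _ hv ↦ g.eq_zero_of_forall fun w ↦ (g.symm x _ w).trans (hv w)⟩

/-- The inverse of the isomorphism `v ↦ g(v, ·)`. -/
def sharp (x : M) : (TangentSpace I x →L[ℝ] ℝ) →L[ℝ] TangentSpace I x :=
  haveI : FiniteDimensional ℝ (TangentSpace I x) := inferInstanceAs (FiniteDimensional ℝ E)
  LinearMap.toContinuousLinearMap
    (((g.bilin x).toDual (g.nondegenerate_bilin x)).symm.toLinearMap.comp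
      (ContinuousLinearMap.coeLM ℝ))

theorem val_sharp (φ : TangentSpace I x →L[ℝ] ℝ) (w : TangentSpace I x) :
    g.val x (g.sharp x φ) w = φ w := by
  have : FiniteDimensional ℝ (TangentSpace I x) := inferInstanceAs (FiniteDimensional ℝ E)
  exact LinearMap.BilinForm.apply_toDual_symm_apply (hB := g.nondegenerate_bilin x) φ.toLinearMap w

open scoped Classical in
/-- The Levi-Civita connection, given by Koszul's formula
(with the junk value `0` where `Y` is not differentiable). -/
def leviCivitaFun (Y : Π x : M, TangentSpace I x) (x : M) :
    TangentSpace I x →L[ℝ] TangentSpace I x :=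
  if hY : MDiffAt (T% Y) x then
    (1 / 2 : ℝ) • (g.sharp x).comp (TensorialAt.mkHom₂ (fun X W ↦ g.koszul X Y W x) x
      (fun _ hW ↦ g.tensorialAt_koszul_left hY hW) (fun _ hX ↦ g.tensorialAt_koszul_right hX hY))
  else 0

theorem val_leviCivitaFun (hX : MDiffAt (T% X) x) (hY : MDiffAt (T% Y) x)
    (hW : MDiffAt (T% W) x) :
    2 * g.val x (g.leviCivitaFun Y x (X x)) (W x) = g.koszul X Y W x := by
  have := TensorialAt.mkHom₂_apply (fun _ hW ↦ g.tensorialAt_koszul_left hY hW)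
    (fun _ hX ↦ g.tensorialAt_koszul_right hX hY) hX hW
  rw [leviCivitaFun, dif_pos hY, smul_apply, map_smul, smul_apply,
    ContinuousLinearMap.comp_apply, val_sharp, this]
  simp

/-- The Levi-Civita connection of a Lorentzian metric. -/
def leviCivita : CovariantDerivative I E (TangentSpace I : M → Type _) where
  toFun := g.leviCivitaFun
  isCovariantDerivativeOnUniv := by
    refine ⟨fun {σ σ' x} hσ hσ' _ ↦ ?_, fun {σ f x} hσ hf _ ↦ ?_⟩
    · ext v
      refine sub_eq_zero.1 (g.eq_zero_of_forall fun w ↦ ?_)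
      have hv := FiberBundle.mdifferentiableAt_extend I E v
      have hw := FiberBundle.mdifferentiableAt_extend I E w
      have h₁ := g.val_leviCivitaFun hv (mdifferentiableAt_add_section hσ hσ') hw
      have h₂ := g.val_leviCivitaFun hv hσ hw
      have h₃ := g.val_leviCivitaFun hv hσ' hw
      rw [g.koszul_add_middle hv hσ hσ' hw] at h₁
      simp only [FiberBundle.extend_apply_self] at h₁ h₂ h₃
      simp only [map_sub, sub_apply, add_apply, map_add]
      linarith
    · ext v
      refine sub_eq_zero.1 (g.eq_zero_of_forall fun w ↦ ?_)
      have hv := FiberBundle.mdifferentiableAt_extend I E v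
      have hw := FiberBundle.mdifferentiableAt_extend I E w
      have h₁ := g.val_leviCivitaFun hv (hf.smul_section hσ) hw
      have h₂ := g.val_leviCivitaFun hv hσ hw
      rw [g.koszul_smul_middle hf hv hσ hw] at h₁
      simp only [FiberBundle.extend_apply_self] at h₁ h₂
      simp only [map_sub, sub_apply, add_apply, map_add, smul_apply, map_smul,
        ContinuousLinearMap.smulRight_apply, smul_eq_mul]
      linear_combination h₁ / 2 - f x * h₂ / 2

/-- The Levi-Civita connection is torsion-free. -/
theorem torsion_leviCivita : g.leviCivita.torsion = 0 := by
  rw [CovariantDerivative.torsion_eq_zero_iff]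
  intro X Y x hX hY
  refine sub_eq_zero.1 (g.eq_zero_of_forall fun w ↦ ?_)
  have hw := FiberBundle.mdifferentiableAt_extend I E w
  have h₁ := g.val_leviCivitaFun hX hY hw
  have h₂ := g.val_leviCivitaFun hY hX hw
  have h₃ := g.koszul_sub_swap (X := X) (Y := Y) (W := FiberBundle.extend E w) (x := x)
  simp only [FiberBundle.extend_apply_self] at h₁ h₂ h₃
  have e (Y) : g.leviCivita Y x = g.leviCivitaFun Y x := rfl
  simp only [map_sub, sub_apply, e]
  linarith

/-- The Levi-Civita connection is compatible with the metric. -/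
theorem mvfderiv_val (v : TangentSpace I x) (hY : MDiffAt (T% Y) x) (hW : MDiffAt (T% W) x) :
    mvfderiv I (fun y ↦ g.val y (Y y) (W y)) x v =
      g.val x (g.leviCivita Y x v) (W x) + g.val x (Y x) (g.leviCivita W x v) := by
  have hv := FiberBundle.mdifferentiableAt_extend I E v
  have h₁ := g.val_leviCivitaFun hv hY hW
  have h₂ := g.val_leviCivitaFun hv hW hY
  have h₃ := g.koszul_add_swap (X := FiberBundle.extend E v) (Y := Y) (W := W) (x := x)
  simp only [FiberBundle.extend_apply_self] at h₁ h₂ h₃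
  have e (Y) : g.leviCivita Y x = g.leviCivitaFun Y x := rfl
  rw [g.symm x (Y x), e, e]
  linarith

end Koszul
end LorentzianMetric

namespace CovariantDerivative

variable {E : Type*} [NormedAddCommGroup E] [NormedSpace ℝ E]
  {H : Type*} [TopologicalSpace H] {I : ModelWithCorners ℝ E H}
  {M : Type*} [TopologicalSpace M] [ChartedSpace H M]
  {E' : Type*} [NormedAddCommGroup E'] [NormedSpace ℝ E']
  {H' : Type*} [TopologicalSpace H'] {J : ModelWithCorners ℝ E' H'}
  {M' : Type*} [TopologicalSpace M'] [ChartedSpace H' M'] [IsManifold J ∞ M']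

/-- The components near `x` of a vector field `V` along `f : M → M'`, in the frame of `T M'` given
by the preferred trivialization at `f x`. -/
def coord {f : M → M'} (V : Π x : M, TangentSpace J (f x)) (x y : M) : E' :=
  (trivializationAt E' (TangentSpace J : M' → Type _) (f x) ⟨f y, V y⟩).2

/-- The connection induced by `cov` on the vector fields along `f : M → M'` (the pullback
connection): `cov.along I V x v` is `∇_v V`. Here `V = ∑ i, Vⁱ eᵢ` near `x`, for a frame `e` of
`T M'` near `f x`, and `∇_v V = ∑ i, (v Vⁱ) eᵢ + ∇_{df v} (∑ i, Vⁱ(x) eᵢ)`. -/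
def along (cov : CovariantDerivative J E' (TangentSpace J : M' → Type _))
    (I : ModelWithCorners ℝ E H) {f : M → M'} (V : Π x : M, TangentSpace J (f x)) (x : M) :
    TangentSpace I x →L[ℝ] TangentSpace J (f x) :=
  ((trivializationAt E' (TangentSpace J : M' → Type _) (f x)).symmL ℝ (f x)).comp
      (mvfderiv I (coord V x) x)
    + (cov (FiberBundle.extend E' (V x)) (f x)).comp (mfderiv I J f x)

variable (cov : CovariantDerivative J E' (TangentSpace J : M' → Type _)) {f : M → M'}
  {V W : Π x : M, TangentSpace J (f x)} {x : M}

theorem eventually_mem_baseSet (hf : ContinuousAt f x) :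
    ∀ᶠ y in 𝓝 x, f y ∈ (trivializationAt E' (TangentSpace J : M' → Type _) (f x)).baseSet :=
  hf.eventually_mem ((trivializationAt E' (TangentSpace J : M' → Type _) (f x)).open_baseSet.mem_nhds
    (FiberBundle.mem_baseSet_trivializationAt' (f x)))

theorem mdifferentiableAt_coord
    (hV : MDifferentiableAt I J.tangent (fun y ↦ (⟨f y, V y⟩ : TangentBundle J M')) x) :
    MDifferentiableAt I 𝓘(ℝ, E') (coord V x) x :=
  ((mdifferentiableAt_totalSpace _ _ ).1 hV).2

theorem mdifferentiableAt_base
    (hV : MDifferentiableAt I J.tangent (fun y ↦ (⟨f y, V y⟩ : TangentBundle J M')) x) :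
    MDifferentiableAt I J f x :=
  ((mdifferentiableAt_totalSpace _ _ ).1 hV).1

theorem mvfderiv_coord_add
    (hV : MDifferentiableAt I J.tangent (fun y ↦ (⟨f y, V y⟩ : TangentBundle J M')) x)
    (hW : MDifferentiableAt I J.tangent (fun y ↦ (⟨f y, W y⟩ : TangentBundle J M')) x) :
    mvfderiv I (coord (fun y ↦ V y + W y) x) x =
      mvfderiv I (coord V x) x + mvfderiv I (coord W x) x := by
  rw [← mvfderiv_add (mdifferentiableAt_coord hV) (mdifferentiableAt_coord hW)]
  refine Filter.EventuallyEq.mfderiv_eq (I' := 𝓘(ℝ, E')) ?_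
  filter_upwards [eventually_mem_baseSet (J := J) (mdifferentiableAt_base hV).continuousAt] with y hy
  exact ((trivializationAt E' (TangentSpace J : M' → Type _) (f x)).linear ℝ hy).map_add (V y) (W y)

theorem mvfderiv_coord_smul {a : M → ℝ} (ha : MDifferentiableAt I 𝓘(ℝ, ℝ) a x)
    (hV : MDifferentiableAt I J.tangent (fun y ↦ (⟨f y, V y⟩ : TangentBundle J M')) x) :
    mvfderiv I (coord (fun y ↦ a y • V y) x) x =
      a x • mvfderiv I (coord V x) x + (mvfderiv I a x).smulRight (coord V x x) := by
  rw [← mvfderiv_smul ha (mdifferentiableAt_coord hV)]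
  refine Filter.EventuallyEq.mfderiv_eq (I' := 𝓘(ℝ, E')) ?_
  filter_upwards [eventually_mem_baseSet (J := J) (mdifferentiableAt_base hV).continuousAt] with y hy
  exact ((trivializationAt E' (TangentSpace J : M' → Type _) (f x)).linear ℝ hy).map_smul (a y) (V y)

theorem symmL_coord (V : Π x : M, TangentSpace J (f x)) :
    (trivializationAt E' (TangentSpace J : M' → Type _) (f x)).symmL ℝ (f x) (coord V x x) = V x := by
  rw [Trivialization.symmL_apply _ (FiberBundle.mem_baseSet_trivializationAt' (f x))]
  exact (trivializationAt E' (TangentSpace J : M' → Type _) (f x)).symm_apply_apply_mk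
    (FiberBundle.mem_baseSet_trivializationAt' (f x)) (V x)

theorem apply_eq [FiniteDimensional ℝ E'] {p : M'} {Y : Π p : M', TangentSpace J p}
    (hY : MDiffAt (T% Y) p) :
    cov Y p = ((trivializationAt E' (TangentSpace J : M' → Type _) p).symmL ℝ p).comp
      (mvfderiv J (coord (f := id) Y p) p) + cov (FiberBundle.extend E' (Y p)) p := by
  have key : TensorialAt J E' (fun Y : Π p : M', TangentSpace J p ↦ cov Y p -
      ((trivializationAt E' (TangentSpace J : M' → Type _) p).symmL ℝ p).comp
      (mvfderiv J (coord (f := id) Y p) p)) p := by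
    constructor
    · intro a σ ha hσ
      have h := mvfderiv_coord_smul (f := id) ha hσ
      change mvfderiv J (coord (f := id) (a • σ) p) p = _ at h
      have h' := symmL_coord (f := id) (x := p) σ
      simp only [id] at h h'
      simp only [h, cov.isCovariantDerivativeOn.leibniz hσ ha]
      ext v
      simp only [sub_apply, add_apply, smul_apply, ContinuousLinearMap.comp_apply, map_add,
        map_smul, ContinuousLinearMap.smulRight_apply, h']
      module
    · intro σ σ' hσ hσ'
      have h := mvfderiv_coord_add (f := id) hσ hσ'
      change mvfderiv J (coord (f := id) (σ + σ') p) p = _ at h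
      simp only [h, cov.isCovariantDerivativeOn.add hσ hσ']
      ext v
      simp only [sub_apply, add_apply, ContinuousLinearMap.comp_apply, map_add]
      module
  have h := key.pointwise hY (FiberBundle.mdifferentiableAt_extend J E' (Y p)) (by simp)
  have h0 (Z : Π q : M', TangentSpace J q) (hZ : Z = FiberBundle.extend E' (Y p)) :
      mvfderiv J (coord (f := id) Z p) p = 0 := by
    rw [← mvfderiv_const (I := J) (x := p) (coord (f := id) Y p p)]
    refine Filter.EventuallyEq.mfderiv_eq (I' := 𝓘(ℝ, E')) ?_
    filter_upwards [eventually_mem_baseSet (J := J) (f := id) (x := p) continuousAt_id] with y hy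
    simp only [id] at hy
    simp [hZ, FiberBundle.extend, coord, Trivialization.apply_mk_symm _ hy]
  simp only [h0 _ rfl] at h
  rw [sub_eq_iff_eq_add] at h
  rw [h]
  simp [add_comm]

/-- On the restriction of a vector field of `M'`, the induced connection is `∇_{df v} Y`. -/
theorem along_comp [FiniteDimensional ℝ E'] {Y : Π p : M', TangentSpace J p}
    (hY : MDiffAt (T% Y) (f x)) (hf : MDifferentiableAt I J f x) :
    cov.along I (fun y ↦ Y (f y)) x = (cov Y (f x)).comp (mfderiv I J f x) := by
  have h : mvfderiv I (coord (fun y ↦ Y (f y)) x) x =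
      (mvfderiv J (coord (f := id) Y (f x)) (f x)).comp (mfderiv I J f x) := by
    have h' : MDifferentiableAt J 𝓘(ℝ, E') (coord (f := id) Y (f x)) (f x) :=
      mdifferentiableAt_coord (J := J) (f := id) (V := Y) hY
    have e : coord (fun y ↦ Y (f y)) x = coord (f := id) Y (f x) ∘ f := rfl
    rw [e]
    exact mfderiv_comp x h' hf
  rw [along, h, apply_eq cov hY, ContinuousLinearMap.add_comp, ContinuousLinearMap.comp_assoc]

theorem along_add
    (hV : MDifferentiableAt I J.tangent (fun y ↦ (⟨f y, V y⟩ : TangentBundle J M')) x)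
    (hW : MDifferentiableAt I J.tangent (fun y ↦ (⟨f y, W y⟩ : TangentBundle J M')) x) :
    cov.along I (fun y ↦ V y + W y) x = cov.along I V x + cov.along I W x := by
  have hV' := FiberBundle.mdifferentiableAt_extend J E' (V x)
  have hW' := FiberBundle.mdifferentiableAt_extend J E' (W x)
  have h : cov (FiberBundle.extend E' (V x + W x)) (f x) =
      cov (FiberBundle.extend E' (V x) + FiberBundle.extend E' (W x)) (f x) := by
    refine cov.isCovariantDerivativeOn.congr_of_eventuallyEq
      (FiberBundle.mdifferentiableAt_extend J E' _) (mdifferentiableAt_add_section hV' hW')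
      Filter.univ_mem ?_
    filter_upwards [eventually_mem_baseSet (J := J) (f := fun p : M' ↦ p) (x := f x) continuousAt_id]
      with y hy
    simp only [FiberBundle.extend, Pi.add_apply, ← Trivialization.symmL_apply (R := ℝ) _ hy,
      ← map_add]
    congr 1
    exact ((trivializationAt E' (TangentSpace J : M' → Type _) (f x)).linear ℝ
      (FiberBundle.mem_baseSet_trivializationAt' (f x))).map_add (V x) (W x)
  rw [along, along, along, mvfderiv_coord_add hV hW, h, cov.isCovariantDerivativeOn.add hV' hW']
  ext v
  simp only [add_apply, ContinuousLinearMap.comp_apply, map_add]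
  module

theorem along_smul {a : M → ℝ} (ha : MDifferentiableAt I 𝓘(ℝ, ℝ) a x)
    (hV : MDifferentiableAt I J.tangent (fun y ↦ (⟨f y, V y⟩ : TangentBundle J M')) x) :
    cov.along I (fun y ↦ a y • V y) x =
      a x • cov.along I V x + (mvfderiv I a x).smulRight (V x) := by
  have hV' := FiberBundle.mdifferentiableAt_extend J E' (V x)
  have h : cov (FiberBundle.extend E' (a x • V x)) (f x) =
      cov (a x • FiberBundle.extend E' (V x)) (f x) := by
    refine cov.isCovariantDerivativeOn.congr_of_eventuallyEq
      (FiberBundle.mdifferentiableAt_extend J E' _) (hV'.smul_const_section) Filter.univ_mem ?_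
    filter_upwards [eventually_mem_baseSet (J := J) (f := fun p : M' ↦ p) (x := f x) continuousAt_id]
      with y hy
    simp only [FiberBundle.extend, Pi.smul_apply, ← Trivialization.symmL_apply (R := ℝ) _ hy,
      ← map_smul]
    congr 1
    exact ((trivializationAt E' (TangentSpace J : M' → Type _) (f x)).linear ℝ
      (FiberBundle.mem_baseSet_trivializationAt' (f x))).map_smul (a x) (V x)
  rw [along, along, mvfderiv_coord_smul ha hV, h, cov.isCovariantDerivativeOn.smul_const _ hV']
  ext v
  simp only [add_apply, ContinuousLinearMap.comp_apply, map_add, smul_apply, map_smul,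
    ContinuousLinearMap.smulRight_apply, symmL_coord]
  module

end CovariantDerivative

/-- The radical `rad(T_x M) = T_x M ∩ (T_x M)^⊥` of the metric induced by `f : M → M'`. -/
def LorentzianMetric.radical {n m : ℕ} {M' : Type*} [TopologicalSpace M']
    [ChartedSpace (EuclideanSpace ℝ (Fin m)) M'] [IsManifold (𝓡 m) ∞ M']
    (g : LorentzianMetric (𝓡 m) M') {M : Type*} [TopologicalSpace M]
    [ChartedSpace (EuclideanSpace ℝ (Fin n)) M] (f : M → M') (x : M) :
    Submodule ℝ (TangentSpace (𝓡 n) x) where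
  carrier := {v | ∀ w : TangentSpace (𝓡 n) x,
    g.val (f x) (mfderiv (𝓡 n) (𝓡 m) f x v) (mfderiv (𝓡 n) (𝓡 m) f x w) = 0}
  add_mem' hv hv' w := by simp [hv w, hv' w]
  zero_mem' w := by simp
  smul_mem' c v hv w := by simp [hv w]

/-- A null hypersurface `(M, g, S(TM))` of the `(n + 2)`-dimensional Lorentzian manifold `(M', g)`:
an immersion `M → M'` of an `(n + 1)`-dimensional manifold such that the induced metric is
degenerate at each point, with a screen distribution, i.e. a smooth vector subbundle of `TM`
complementary to the radical bundle. -/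
structure NullHypersurface {n : ℕ} {M' : Type*} [TopologicalSpace M']
    [ChartedSpace (EuclideanSpace ℝ (Fin (n + 2))) M'] [IsManifold (𝓡 (n + 2)) ∞ M']
    (g : LorentzianMetric (𝓡 (n + 2)) M') (M : Type*) [TopologicalSpace M]
    [ChartedSpace (EuclideanSpace ℝ (Fin (n + 1))) M] [IsManifold (𝓡 (n + 1)) ∞ M] where
  /-- The immersion. -/
  toFun : M → M'
  contMDiff_toFun : ContMDiff (𝓡 (n + 1)) (𝓡 (n + 2)) ∞ toFun
  injective_mfderiv (x : M) : Function.Injective (mfderiv (𝓡 (n + 1)) (𝓡 (n + 2)) toFun x)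
  exists_radical (x : M) : ∃ ξ ∈ g.radical (n := n + 1) toFun x, ξ ≠ 0
  /-- The screen distribution. -/
  screen (x : M) : Submodule ℝ (TangentSpace (𝓡 (n + 1)) x)
  isCompl_screen (x : M) : IsCompl (screen x) (g.radical (n := n + 1) toFun x)
  exists_frame (x : M) : ∃ (U : Set M) (s : Fin n → Π y : M, TangentSpace (𝓡 (n + 1)) y),
    IsOpen U ∧ x ∈ U ∧
    (∀ i, ContMDiffOn (𝓡 (n + 1)) (𝓡 (n + 1)).tangent ∞
      (fun y ↦ (⟨y, s i y⟩ : TangentBundle (𝓡 (n + 1)) M)) U) ∧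
    ∀ y ∈ U, LinearIndependent ℝ (fun i ↦ s i y) ∧
      Submodule.span ℝ (Set.range fun i ↦ s i y) = screen y

namespace NullHypersurface

variable {n : ℕ} {M' : Type*} [TopologicalSpace M']
    [ChartedSpace (EuclideanSpace ℝ (Fin (n + 2))) M'] [IsManifold (𝓡 (n + 2)) ∞ M']
    {g : LorentzianMetric (𝓡 (n + 2)) M'} {M : Type*} [TopologicalSpace M]
    [ChartedSpace (EuclideanSpace ℝ (Fin (n + 1))) M] [IsManifold (𝓡 (n + 1)) ∞ M]
    (S : NullHypersurface g M)

/-- The differential of the immersion at `x`. -/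
abbrev d (x : M) : TangentSpace (𝓡 (n + 1)) x →L[ℝ] TangentSpace (𝓡 (n + 2)) (S.toFun x) :=
  mfderiv (𝓡 (n + 1)) (𝓡 (n + 2)) S.toFun x

/-- The fibre of the radical bundle `rad(TM)`. -/
abbrev rad (x : M) : Submodule ℝ (TangentSpace (𝓡 (n + 1)) x) := g.radical (n := n + 1) S.toFun x

/-- The fibre at `x` of the transversal bundle `tr(TM)`, spanned by the vectors `N` with
`g(ξ, N) = 1` for some `ξ` in the radical, `g(N, N) = 0` and `g(N, X) = 0` for `X` in the screen
distribution. -/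
def transversal (x : M) : Submodule ℝ (TangentSpace (𝓡 (n + 2)) (S.toFun x)) :=
  Submodule.span ℝ {N | (∃ ξ ∈ S.rad x, g.val (S.toFun x) (S.d x ξ) N = 1) ∧
    g.val (S.toFun x) N N = 0 ∧ ∀ X ∈ S.screen x, g.val (S.toFun x) N (S.d x X) = 0}

theorem exists_null (x : M) : ∃ ξ ∈ S.rad x, ∃ N : TangentSpace (𝓡 (n + 2)) (S.toFun x),
    g.val (S.toFun x) (S.d x ξ) N = 1 ∧ g.val (S.toFun x) N N = 0 ∧
    ∀ X ∈ S.screen x, g.val (S.toFun x) N (S.d x X) = 0 := by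
  obtain ⟨ξ, hξ, hξ0⟩ := S.exists_radical x
  have hnot : ξ ∉ S.screen x := fun h ↦
    hξ0 (Submodule.disjoint_def.1 (S.isCompl_screen x).disjoint ξ h hξ)
  obtain ⟨φ, hφ, hφS⟩ := Submodule.exists_le_ker_of_notMem hnot
  obtain ⟨L, hL⟩ := LinearMap.exists_leftInverse_of_injective (S.d x).toLinearMap
    (LinearMap.ker_eq_bot.2 (S.injective_mfderiv x))
  have hL' (v) : L (S.d x v) = v := congrArg (fun F ↦ F v) hL
  have : FiniteDimensional ℝ (TangentSpace (𝓡 (n + 2)) (S.toFun x)) :=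
    inferInstanceAs (FiniteDimensional ℝ (EuclideanSpace ℝ (Fin (n + 2))))
  have : T2Space (TangentSpace (𝓡 (n + 2)) (S.toFun x)) :=
    inferInstanceAs (T2Space (EuclideanSpace ℝ (Fin (n + 2))))
  have : IsTopologicalAddGroup (TangentSpace (𝓡 (n + 2)) (S.toFun x)) :=
    inferInstanceAs (IsTopologicalAddGroup (EuclideanSpace ℝ (Fin (n + 2))))
  set w := g.sharp (S.toFun x) (LinearMap.toContinuousLinearMap (φ ∘ₗ L)) with hw
  have hwv (v) : g.val (S.toFun x) w (S.d x v) = φ v := by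
    rw [hw, LorentzianMetric.val_sharp]
    simp [hL']
  have hξξ : g.val (S.toFun x) (S.d x ξ) (S.d x ξ) = 0 := hξ ξ
  refine ⟨(φ ξ)⁻¹ • ξ, (S.rad x).smul_mem _ hξ,
    w - (g.val (S.toFun x) w w / (2 * φ ξ)) • S.d x ξ, ?_, ?_, fun X hX ↦ ?_⟩
  · simp only [map_smul, map_sub, smul_apply, smul_eq_mul, hξξ, g.symm _ (S.d x ξ) w, hwv]
    field_simp
    ring
  · simp only [map_smul, map_sub, smul_apply, sub_apply, smul_eq_mul, hξξ,
      g.symm _ (S.d x ξ) w, hwv]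
    field_simp
    ring
  · have : φ X = 0 := hφS hX
    simp only [map_smul, map_sub, smul_apply, sub_apply, smul_eq_mul, hwv, this, hξ X]
    simp

theorem isCompl_transversal (x : M) :
    IsCompl (LinearMap.range (S.d x).toLinearMap) (S.transversal x) := by
  have : FiniteDimensional ℝ (TangentSpace (𝓡 (n + 2)) (S.toFun x)) :=
    inferInstanceAs (FiniteDimensional ℝ (EuclideanSpace ℝ (Fin (n + 2))))
  have hd : Module.finrank ℝ (TangentSpace (𝓡 (n + 2)) (S.toFun x)) = n + 2 :=
    (finrank_euclideanSpace_fin : Module.finrank ℝ (EuclideanSpace ℝ (Fin (n + 2))) = n + 2)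
  have hd' : Module.finrank ℝ (TangentSpace (𝓡 (n + 1)) x) = n + 1 :=
    (finrank_euclideanSpace_fin : Module.finrank ℝ (EuclideanSpace ℝ (Fin (n + 1))) = n + 1)
  obtain ⟨ξ, hξ, N, hN1, hN2, hN3⟩ := S.exists_null x
  set W := LinearMap.range (S.d x).toLinearMap with hW
  have hWd : Module.finrank ℝ W = n + 1 := by
    rw [hW, LinearMap.finrank_range_of_inj (S.injective_mfderiv x), hd']
  have hWo : Module.finrank ℝ ((g.bilin (S.toFun x)).orthogonal W) = 1 := by
    have := LinearMap.BilinForm.finrank_orthogonal (g.nondegenerate_bilin (S.toFun x)) W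
    omega
  have hmem (v : TangentSpace (𝓡 (n + 2)) (S.toFun x)) : v ∈ (g.bilin (S.toFun x)).orthogonal W ↔
      ∀ X, g.val (S.toFun x) v (S.d x X) = 0 := by
    rw [LinearMap.BilinForm.mem_orthogonal_iff]
    refine ⟨fun h X ↦ (g.symm _ _ _).trans (h _ ⟨X, rfl⟩), ?_⟩
    rintro h _ ⟨X, rfl⟩
    exact (g.symm _ _ _).trans (h X)
  have hξ0 : S.d x ξ ≠ 0 := fun h ↦ by simp [h] at hN1
  have hmul (v) (hv : ∀ X, g.val (S.toFun x) v (S.d x X) = 0) : ∃ c : ℝ, c • S.d x ξ = v := by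
    have h1 := (hmem _).2 hξ
    obtain ⟨c, hc⟩ := exists_smul_eq_of_finrank_eq_one hWo
      (x := ⟨S.d x ξ, h1⟩) (by simpa using hξ0) ⟨v, (hmem v).2 hv⟩
    exact ⟨c, congrArg Subtype.val hc⟩
  have hspan : S.transversal x = Submodule.span ℝ {N} := by
    apply le_antisymm
    · refine Submodule.span_le.2 ?_
      rintro N' ⟨⟨ξ', hξ', h1⟩, h2, h3⟩
      obtain ⟨c, hc⟩ := hmul (S.d x ξ') hξ'
      have hc1 : c * g.val (S.toFun x) (S.d x ξ) N' = 1 := by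
        rw [← hc] at h1
        simpa using h1
      obtain ⟨k, hk⟩ := hmul (c • N' - N) fun X ↦ by
        obtain ⟨s, hs, r, hr, rfl⟩ := Submodule.mem_sup.1
          (((S.isCompl_screen x).sup_eq_top).symm ▸ Submodule.mem_top : X ∈ S.screen x ⊔ _)
        obtain ⟨e, he⟩ := hmul (S.d x r) hr
        simp only [map_sub, map_add, map_smul, sub_apply, smul_apply, h3 s hs, hN3 s hs, ← he,
          smul_eq_mul, g.symm _ _ (S.d x ξ), hN1]
        linear_combination e * hc1
      have hk' : c • N' = N + k • S.d x ξ := by rw [hk]; abel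
      have hk0 : k = 0 := by
        have h := congrArg (fun v ↦ g.val (S.toFun x) v v) hk'
        have hξξ : g.val (S.toFun x) (S.d x ξ) (S.d x ξ) = 0 := hξ ξ
        simp only [map_add, map_smul, add_apply, smul_apply, smul_eq_mul, h2, hN2, hξξ,
          g.symm _ N (S.d x ξ), hN1] at h
        linarith
      have hc0 : c ≠ 0 := by rintro rfl; simp at hc1
      rw [hk0, zero_smul, add_zero] at hk'
      exact Submodule.mem_span_singleton.2 ⟨c⁻¹, by rw [← hk', inv_smul_smul₀ hc0]⟩
    · exact Submodule.span_mono (Set.singleton_subset_iff.2 ⟨⟨ξ, hξ, hN1⟩, hN2, hN3⟩)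
  have hN0 : N ≠ 0 := by rintro rfl; simp at hN1
  have hdisj : Disjoint W (S.transversal x) := by
    rw [hspan, Submodule.disjoint_def]
    rintro _ ⟨X, rfl⟩ h
    obtain ⟨c, hc⟩ := Submodule.mem_span_singleton.1 h
    have h1 : g.val (S.toFun x) (S.d x ξ) (S.d x X) = 0 := hξ X
    have h2 : g.val (S.toFun x) (S.d x ξ) (c • N) = c := by simp [hN1]
    rw [hc] at h2
    have : c = 0 := h2.symm.trans h1
    rw [← hc, this, zero_smul]
  refine ⟨hdisj, codisjoint_iff.2 (Submodule.eq_top_of_disjoint _ _ ?_ hdisj)⟩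
  rw [hWd, hspan, finrank_span_singleton hN0, hd]

/-- The projection `T_{f x} M' = T_x M ⊕ tr(TM)_x → T_x M`. -/
def tangentProj (x : M) :
    TangentSpace (𝓡 (n + 2)) (S.toFun x) →ₗ[ℝ] TangentSpace (𝓡 (n + 1)) x :=
  (LinearEquiv.ofInjective (S.d x).toLinearMap (S.injective_mfderiv x)).symm.toLinearMap ∘ₗ
    Submodule.projectionOnto _ _ (S.isCompl_transversal x)

/-- The projection `P : T_x M = S(TM)_x ⊕ rad(TM)_x → S(TM)_x`. -/
def screenProj (x : M) : TangentSpace (𝓡 (n + 1)) x →ₗ[ℝ] TangentSpace (𝓡 (n + 1)) x :=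
  Submodule.projection _ _ (S.isCompl_screen x)

/-- The Levi-Civita connection of `M'` on vector fields along `M`: `S.ambientConn V x v` is
`∇_v V` at `x`. -/
def ambientConn (V : Π x : M, TangentSpace (𝓡 (n + 2)) (S.toFun x)) (x : M) :
    TangentSpace (𝓡 (n + 1)) x →L[ℝ] TangentSpace (𝓡 (n + 2)) (S.toFun x) :=
  g.leviCivita.along (𝓡 (n + 1)) V x

/-- The induced connection of `M`: the tangential component of `∇_v Y`. -/
def inducedConn (Y : Π x : M, TangentSpace (𝓡 (n + 1)) x) (x : M) :
    TangentSpace (𝓡 (n + 1)) x →ₗ[ℝ] TangentSpace (𝓡 (n + 1)) x :=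
  S.tangentProj x ∘ₗ (S.ambientConn (fun y ↦ S.d y (Y y)) x).toLinearMap

/-- The screen connection `∇*`: the screen component of the induced connection, for sections
`Y` of the screen distribution. -/
def screenConn (Y : Π x : M, TangentSpace (𝓡 (n + 1)) x) (x : M) :
    TangentSpace (𝓡 (n + 1)) x →ₗ[ℝ] TangentSpace (𝓡 (n + 1)) x :=
  S.screenProj x ∘ₗ S.inducedConn Y x

/-- The screen component `Z*` of a vector field `Z` along `M`, in the decomposition
`T M' = S(TM) ⊕ rad(TM) ⊕ tr(TM)`. -/
def star (Z : Π x : M, TangentSpace (𝓡 (n + 2)) (S.toFun x)) (x : M) :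
    TangentSpace (𝓡 (n + 1)) x :=
  S.screenProj x (S.tangentProj x (Z x))

/-- The component `Z^⊥ = Z - Z*` of `Z` in `S(TM)^⊥ = rad(TM) ⊕ tr(TM)`. -/
def perp (Z : Π x : M, TangentSpace (𝓡 (n + 2)) (S.toFun x)) (x : M) :
    TangentSpace (𝓡 (n + 2)) (S.toFun x) :=
  Z x - S.d x (S.star Z x)

/-- The shape operator `A_V` of the screen distribution in the direction of a section `V` of
`S(TM)^⊥`: `-A_V v` is the `S(TM)` component of `∇_v V` in the decomposition
`T M' = S(TM) ⊕ S(TM)^⊥`. -/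
def shape (V : Π x : M, TangentSpace (𝓡 (n + 2)) (S.toFun x)) (x : M) :
    Module.End ℝ (TangentSpace (𝓡 (n + 1)) x) :=
  -(S.screenProj x ∘ₗ S.tangentProj x ∘ₗ (S.ambientConn V x).toLinearMap)

/-- The induced degenerate metric on `T_x M`. -/
def metric (x : M) (v w : TangentSpace (𝓡 (n + 1)) x) : ℝ :=
  g.val (S.toFun x) (S.d x v) (S.d x w)

/-- The normalization `T = Z* / |Z*|` of the screen component of `Z`. -/
def unitStar (Z : Π x : M, TangentSpace (𝓡 (n + 2)) (S.toFun x)) (x : M) :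
    TangentSpace (𝓡 (n + 1)) x :=
  (√(S.metric x (S.star Z x) (S.star Z x)))⁻¹ • S.star Z x

/-- The screen distribution is integrable: each point of `M` lies on an (immersed) integral
manifold, given here by a local parametrization. -/
def ScreenIntegrable : Prop :=
  ∀ x : M, ∃ (U : Set (EuclideanSpace ℝ (Fin n))) (c : EuclideanSpace ℝ (Fin n) → M),
    IsOpen U ∧ 0 ∈ U ∧ c 0 = x ∧ ContMDiffOn (𝓡 n) (𝓡 (n + 1)) ∞ c U ∧
    ∀ u ∈ U, Function.Injective (mfderiv (𝓡 n) (𝓡 (n + 1)) c u) ∧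
      LinearMap.range (mfderiv (𝓡 n) (𝓡 (n + 1)) c u).toLinearMap = S.screen (c u)

/-- `Z` is a closed conformal vector field along `M` with associated function `φ`:
both are smooth and `∇_X Z = φ X` for all `X` tangent to `M`. -/
structure IsClosedConformal (Z : Π x : M, TangentSpace (𝓡 (n + 2)) (S.toFun x)) (φ : M → ℝ) :
    Prop where
  contMDiff : ContMDiff (𝓡 (n + 1)) (𝓡 (n + 2)).tangent ∞
    (fun x ↦ (⟨S.toFun x, Z x⟩ : TangentBundle (𝓡 (n + 2)) M'))
  contMDiff_fun : ContMDiff (𝓡 (n + 1)) 𝓘(ℝ, ℝ) ∞ φ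
  conn_eq (x : M) (v : TangentSpace (𝓡 (n + 1)) x) : S.ambientConn Z x v = φ x • S.d x v

/-- A closed conformal vector field of the ambient manifold restricts to a closed conformal vector
field along `M`. -/
theorem isClosedConformal_restrict {Z : Π p : M', TangentSpace (𝓡 (n + 2)) p} {φ : M' → ℝ}
    (hZ : ContMDiff (𝓡 (n + 2)) (𝓡 (n + 2)).tangent ∞
      (fun p ↦ (⟨p, Z p⟩ : TangentBundle (𝓡 (n + 2)) M')))
    (hφ : ContMDiff (𝓡 (n + 2)) 𝓘(ℝ, ℝ) ∞ φ)
    (h : ∀ (p : M') (v : TangentSpace (𝓡 (n + 2)) p), g.leviCivita Z p v = φ p • v) :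
    S.IsClosedConformal (fun x ↦ Z (S.toFun x)) (fun x ↦ φ (S.toFun x)) where
  contMDiff := hZ.comp S.contMDiff_toFun
  contMDiff_fun := hφ.comp S.contMDiff_toFun
  conn_eq x v := by
    rw [ambientConn, CovariantDerivative.along_comp _ (hZ.mdifferentiableAt (by simp))
      (S.contMDiff_toFun.mdifferentiableAt (by simp))]
    exact h _ _

/-- `Z` is a canonical principal direction with respect to `A_{Z^⊥}`: at each point `Z*` is a
(nonzero) eigenvector of `A_{Z^⊥}`. -/
def HasCanonicalPrincipalDirection (Z : Π x : M, TangentSpace (𝓡 (n + 2)) (S.toFun x)) : Prop :=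
  ∃ k : M → ℝ, ∀ x, (S.shape (S.perp Z) x).HasEigenvector (k x) (S.star Z x)

/-- `Y` is a geodesic vector field on `S(TM)`: a smooth section of `S(TM)` with `∇*_Y Y = 0`. -/
structure IsScreenGeodesic (Y : Π x : M, TangentSpace (𝓡 (n + 1)) x) : Prop where
  mem_screen (x : M) : Y x ∈ S.screen x
  contMDiff : ContMDiff (𝓡 (n + 1)) (𝓡 (n + 1)).tangent ∞
    (fun x ↦ (⟨x, Y x⟩ : TangentBundle (𝓡 (n + 1)) M))
  conn_eq_zero (x : M) : S.screenConn Y x (Y x) = 0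

end NullHypersurface

end

/-! Write `Z = Z^⊥ + Z*` and take the screen component of `∇_v Z = φ v` for `v` in the screen: this
gives `A_{Z^⊥} v = ∇*_v Z* - φ v` (`IsClosedConformal.shape_perp`). Since `T` is a multiple of the
eigenvector `Z*`, with `A_{Z^⊥} T = κ T`, it follows that `∇*_T Z* = (κ + φ) T`. Pairing with the
unit field `T` gives `κ = g(∇*_T Z*, T) - φ`. For the geodesic equation, the Leibniz rule for `T =
|Z*|⁻¹ Z*` (`screenConn_smul`) makes `∇*_T T` a multiple of `Z*`. Since `|T| = 1`, metric
compatibility makes it orthogonal to `T` (`metric_screenConn_self`). The metric is positive definite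
on the screen (`metric_self_pos`), so the multiple is zero. Two supporting facts carry most of the
work: the connection along the immersion is metric (`LorentzianMetric.mvfderiv_val_along`), and the
screen component of a smooth field along `M` is smooth (`contMDiff_star`). -/

noncomputable section

open Bundle
open scoped Topology

/-! ### Product rules for manifold derivatives of evaluations of linear and bilinear maps. -/

section MFDeriv

variable {E : Type*} [NormedAddCommGroup E] [NormedSpace ℝ E]
  {H : Type*} [TopologicalSpace H] {I : ModelWithCorners ℝ E H}
  {M : Type*} [TopologicalSpace M] [ChartedSpace H M]
  {F G : Type*} [NormedAddCommGroup F] [NormedSpace ℝ F] [NormedAddCommGroup G] [NormedSpace ℝ G]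

theorem HasMFDerivAt.clm_apply {c : M → F →L[ℝ] G} {u : M → F} {x : M}
    {c' : E →L[ℝ] F →L[ℝ] G} {u' : E →L[ℝ] F}
    (hc : HasMFDerivAt I 𝓘(ℝ, F →L[ℝ] G) c x c') (hu : HasMFDerivAt I 𝓘(ℝ, F) u x u') :
    HasMFDerivAt I 𝓘(ℝ, G) (fun y ↦ c y (u y)) x
      ((c x).comp u' + c'.flip (u x) : E →L[ℝ] G) := by
  refine ⟨hc.1.clm_apply hu.1, ?_⟩
  have hc₂ : HasFDerivWithinAt (c ∘ (extChartAt I x).symm) c' (Set.range I) (extChartAt I x x) :=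
    hc.2
  have hu₂ : HasFDerivWithinAt (u ∘ (extChartAt I x).symm) u' (Set.range I) (extChartAt I x x) :=
    hu.2
  have h := hc₂.clm_apply hu₂
  -- The rule in the chart evaluates `c` and `u` at the preimage of the chart image of `x`, which is
  -- `x` itself.
  simp only [Function.comp_apply, extChartAt_to_inv] at h
  exact h

theorem mvfderiv_clm_apply₂ {c : M → F →L[ℝ] F →L[ℝ] ℝ} {u w : M → F} {x : M}
    (hc : MDifferentiableAt I 𝓘(ℝ, F →L[ℝ] F →L[ℝ] ℝ) c x)
    (hu : MDifferentiableAt I 𝓘(ℝ, F) u x) (hw : MDifferentiableAt I 𝓘(ℝ, F) w x)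
    (v : TangentSpace I x) :
    mvfderiv I (fun y ↦ c y (u y) (w y)) x v =
      mvfderiv I c x v (u x) (w x) + c x (mvfderiv I u x v) (w x)
        + c x (u x) (mvfderiv I w x v) := by
  have h := (hc.hasMFDerivAt.clm_apply hu.hasMFDerivAt).clm_apply hw.hasMFDerivAt
  have h' := congrArg (fun L : E →L[ℝ] ℝ ↦ L v) h.mfderiv
  refine h'.trans ?_
  change c x (u x) (mvfderiv I w x v)
    + (c x (mvfderiv I u x v) (w x) + mvfderiv I c x v (u x) (w x)) = _
  ring

end MFDeriv

/-! ### Metric compatibility of the connection along a map. -/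

namespace LorentzianMetric

variable {E' : Type*} [NormedAddCommGroup E'] [NormedSpace ℝ E']
  {H' : Type*} [TopologicalSpace H'] {J : ModelWithCorners ℝ E' H'}
  {M' : Type*} [TopologicalSpace M'] [ChartedSpace H' M'] [IsManifold J ∞ M']
  (g : LorentzianMetric J M')
  {E : Type*} [NormedAddCommGroup E] [NormedSpace ℝ E]
  {H : Type*} [TopologicalSpace H] {I : ModelWithCorners ℝ E H}
  {M : Type*} [TopologicalSpace M] [ChartedSpace H M]
  {f : M → M'} {V W : Π x : M, TangentSpace J (f x)} {x : M}

/-- The metric near `p` in the preferred trivialization of the tangent bundle at `p`. -/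
def inTrivialization (p q : M') : E' →L[ℝ] E' →L[ℝ] ℝ :=
  ContinuousLinearMap.inCoordinates E' (TangentSpace J) (E' →L[ℝ] ℝ)
    (fun q : M' ↦ TangentSpace J q →L[ℝ] ℝ) p q p q (g.val q)

theorem mdifferentiableAt_inTrivialization (p : M') :
    MDifferentiableAt J 𝓘(ℝ, E' →L[ℝ] E' →L[ℝ] ℝ) (g.inTrivialization p) p :=
  ((mdifferentiableAt_hom_bundle _).1 (g.contMDiff.mdifferentiableAt (x := p) (by simp))).2

theorem inTrivialization_apply {p q : M'}
    (hq : q ∈ (trivializationAt E' (TangentSpace J : M' → Type _) p).baseSet) (a b : E') :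
    g.inTrivialization p q a b =
      g.val q ((trivializationAt E' (TangentSpace J : M' → Type _) p).symm q a)
        ((trivializationAt E' (TangentSpace J : M' → Type _) p).symm q b) := by
  rw [inTrivialization]
  refine (inCoordinates_apply_eq₂ (F₃ := ℝ) (E₃ := Bundle.Trivial M' ℝ) hq hq
    (Set.mem_univ _)).trans ?_
  simp

theorem val_eq_inTrivialization_coord {y : M}
    (hy : f y ∈ (trivializationAt E' (TangentSpace J : M' → Type _) (f x)).baseSet) :
    g.val (f y) (V y) (W y) = g.inTrivialization (f x) (f y)
      (CovariantDerivative.coord V x y) (CovariantDerivative.coord W x y) := by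
  rw [inTrivialization_apply _ hy, CovariantDerivative.coord, CovariantDerivative.coord,
    Trivialization.symm_apply_apply_mk _ hy, Trivialization.symm_apply_apply_mk _ hy]

variable [FiniteDimensional ℝ E'] [CompleteSpace E']

set_option synthInstance.maxHeartbeats 200000 in
/-- The connection along a map induced by the Levi-Civita connection is compatible with the
metric. -/
theorem mvfderiv_val_along
    (hV : MDifferentiableAt I J.tangent (fun y ↦ (⟨f y, V y⟩ : TangentBundle J M')) x)
    (hW : MDifferentiableAt I J.tangent (fun y ↦ (⟨f y, W y⟩ : TangentBundle J M')) x)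
    (v : TangentSpace I x) :
    mvfderiv I (fun y ↦ g.val (f y) (V y) (W y)) x v =
      g.val (f x) (g.leviCivita.along I V x v) (W x)
        + g.val (f x) (V x) (g.leviCivita.along I W x v) := by
  have hf := CovariantDerivative.mdifferentiableAt_base hV
  have hG := g.mdifferentiableAt_inTrivialization (f x)
  have hx := FiberBundle.mem_baseSet_trivializationAt' (F := E')
    (E := (TangentSpace J : M' → Type _)) (f x)
  -- In the trivialization at `f x` the product is `G(f y)(V, W)` with `G` the coordinate form of
  -- the metric, so the product rule `h₆` gives one term in the derivative of `G` and two in the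
  -- derivatives of the coordinates.
  have h₁ : mvfderiv I (fun y ↦ g.val (f y) (V y) (W y)) x =
      mvfderiv I (fun y ↦ g.inTrivialization (f x) (f y)
        (CovariantDerivative.coord V x y) (CovariantDerivative.coord W x y)) x := by
    refine Filter.EventuallyEq.mfderiv_eq (I' := 𝓘(ℝ, ℝ)) ?_
    filter_upwards [CovariantDerivative.eventually_mem_baseSet (J := J) hf.continuousAt] with y hy
    exact g.val_eq_inTrivialization_coord hy
  have h₂ : mvfderiv I (fun y ↦ g.inTrivialization (f x) (f y)) x v =
      mvfderiv J (g.inTrivialization (f x)) (f x) (mfderiv I J f x v) :=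
    congrArg (fun L : E →L[ℝ] E' →L[ℝ] E' →L[ℝ] ℝ ↦ L v) (mfderiv_comp x hG hf)
  -- The extensions of `V x` and `W x` have constant coordinates, so the derivative of their product
  -- is exactly the derivative of `G`. Compatibility on `M'` turns it into the two terms `∇_{df v}`
  -- appearing in the definition of `along`.
  have h₃ := g.mvfderiv_val (mfderiv I J f x v)
    (FiberBundle.mdifferentiableAt_extend J E' (V x))
    (FiberBundle.mdifferentiableAt_extend J E' (W x))
  have h₄ : mvfderiv J (fun q ↦ g.val q (FiberBundle.extend E' (V x) q)
        (FiberBundle.extend E' (W x) q)) (f x) =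
      mvfderiv J (fun q ↦ g.inTrivialization (f x) q
        (CovariantDerivative.coord V x x) (CovariantDerivative.coord W x x)) (f x) := by
    refine Filter.EventuallyEq.mfderiv_eq (I' := 𝓘(ℝ, ℝ)) ?_
    filter_upwards [CovariantDerivative.eventually_mem_baseSet (J := J) (f := fun p : M' ↦ p)
      (x := f x) continuousAt_id] with q hq
    rw [inTrivialization_apply _ hq]
    rfl
  have h₅ := mvfderiv_clm_apply₂ hG (mdifferentiableAt_const (c := CovariantDerivative.coord V x x))
    (mdifferentiableAt_const (c := CovariantDerivative.coord W x x)) (mfderiv I J f x v)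
  have h₆ := mvfderiv_clm_apply₂ (hG.comp x hf) (CovariantDerivative.mdifferentiableAt_coord hV)
    (CovariantDerivative.mdifferentiableAt_coord hW) v
  have hsymm (a : E') := Trivialization.symmL_apply (R := ℝ)
    (trivializationAt E' (TangentSpace J : M' → Type _) (f x)) hx a
  have hV' := CovariantDerivative.symmL_coord (J := J) (x := x) V
  have hW' := CovariantDerivative.symmL_coord (J := J) (x := x) W
  rw [hsymm] at hV' hW'
  simp only [mvfderiv_const, Function.comp_def, zero_apply, map_zero, add_zero,
    FiberBundle.extend_apply_self] at h₃ h₅ h₆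
  rw [h₁, h₆, h₂, ← h₅, ← h₄, h₃, inTrivialization_apply _ hx, inTrivialization_apply _ hx,
    hV', hW']
  simp only [CovariantDerivative.along, add_apply, ContinuousLinearMap.comp_apply, map_add, hsymm]
  ring

end LorentzianMetric

/-! ### Pointwise linear algebra: the projections and positivity on the screen. -/

namespace NullHypersurface

variable {n : ℕ} {M' : Type*} [TopologicalSpace M']
    [ChartedSpace (EuclideanSpace ℝ (Fin (n + 2))) M'] [IsManifold (𝓡 (n + 2)) ∞ M']
    {g : LorentzianMetric (𝓡 (n + 2)) M'} {M : Type*} [TopologicalSpace M]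
    [ChartedSpace (EuclideanSpace ℝ (Fin (n + 1))) M] [IsManifold (𝓡 (n + 1)) ∞ M]
    (S : NullHypersurface g M)

section Pointwise

variable {x : M}

theorem screenProj_mem (v : TangentSpace (𝓡 (n + 1)) x) : S.screenProj x v ∈ S.screen x :=
  Submodule.projection_apply_mem _ v

theorem screenProj_of_mem {v : TangentSpace (𝓡 (n + 1)) x} (hv : v ∈ S.screen x) :
    S.screenProj x v = v :=
  Submodule.projection_apply_left (S.isCompl_screen x) ⟨v, hv⟩

theorem sub_screenProj_mem_rad (v : TangentSpace (𝓡 (n + 1)) x) :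
    v - S.screenProj x v ∈ S.rad x := by
  have h := Submodule.projection_add_projection_eq_self (S.isCompl_screen x) v
  have : v - S.screenProj x v = Submodule.projection _ _ (S.isCompl_screen x).symm v :=
    sub_eq_iff_eq_add'.2 h.symm
  rw [this]
  exact Submodule.projection_apply_mem _ v

theorem tangentProj_d (v : TangentSpace (𝓡 (n + 1)) x) : S.tangentProj x (S.d x v) = v := by
  have h := Submodule.projectionOnto_apply_left (S.isCompl_transversal x) ⟨S.d x v, v, rfl⟩
  simp only [tangentProj, LinearMap.comp_apply]
  erw [h]
  exact (LinearEquiv.ofInjective (S.d x).toLinearMap (S.injective_mfderiv x)).symm_apply_apply v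

theorem sub_d_tangentProj_mem (w : TangentSpace (𝓡 (n + 2)) (S.toFun x)) :
    w - S.d x (S.tangentProj x w) ∈ S.transversal x := by
  obtain ⟨a, ⟨v, rfl⟩, b, hb, rfl⟩ := Submodule.mem_sup.1
    ((S.isCompl_transversal x).sup_eq_top.symm ▸ Submodule.mem_top :
      w ∈ LinearMap.range (S.d x).toLinearMap ⊔ S.transversal x)
  have h0 : S.tangentProj x b = 0 := by
    simp [tangentProj, (Submodule.projectionOnto_apply_eq_zero_iff (S.isCompl_transversal x)).2 hb]
  have h1 : S.tangentProj x (S.d x v + b) = v := by rw [map_add, h0, tangentProj_d, add_zero]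
  change S.d x v + b - S.d x (S.tangentProj x (S.d x v + b)) ∈ _
  rw [h1, add_sub_cancel_left]
  exact hb

theorem val_transversal_screen {w : TangentSpace (𝓡 (n + 2)) (S.toFun x)}
    (hw : w ∈ S.transversal x) {X : TangentSpace (𝓡 (n + 1)) x} (hX : X ∈ S.screen x) :
    g.val (S.toFun x) w (S.d x X) = 0 := by
  induction hw using Submodule.span_induction with
  | mem w h => exact h.2.2 X hX
  | zero => simp
  | add a b _ _ ha hb => simp [ha, hb]
  | smul c a _ ha => simp [ha]

/-- The screen component of `w` has the same inner products with the screen as `w`. -/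
theorem metric_screenProj_tangentProj (w : TangentSpace (𝓡 (n + 2)) (S.toFun x))
    {X : TangentSpace (𝓡 (n + 1)) x} (hX : X ∈ S.screen x) :
    S.metric x (S.screenProj x (S.tangentProj x w)) X = g.val (S.toFun x) w (S.d x X) := by
  -- What the two projections discard is a transversal part and a radical part, and each is
  -- orthogonal to the screen.
  have h1 := S.val_transversal_screen (S.sub_d_tangentProj_mem w) hX
  have h2 : g.val (S.toFun x) (S.d x (S.tangentProj x w - S.screenProj x (S.tangentProj x w)))
    (S.d x X) = 0 := S.sub_screenProj_mem_rad (S.tangentProj x w) X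
  simp only [map_sub, sub_apply] at h1 h2
  rw [metric]
  linarith

/-- The metric is positive definite on the screen. -/
theorem metric_self_pos {X : TangentSpace (𝓡 (n + 1)) x} (hX : X ∈ S.screen x) (hX0 : X ≠ 0) :
    0 < S.metric x X X := by
  obtain ⟨ξ, hξ, hξ0⟩ := S.exists_radical x
  obtain ⟨t, ht, hpos⟩ := g.exists_timelike (S.toFun x)
  have hinj {v : TangentSpace (𝓡 (n + 1)) x} (hv : v ≠ 0) : S.d x v ≠ 0 := fun h ↦
    hv (S.injective_mfderiv x (h.trans (map_zero _).symm))
  have hξξ : g.val (S.toFun x) (S.d x ξ) (S.d x ξ) = 0 := hξ ξ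
  have hξX : g.val (S.toFun x) (S.d x ξ) (S.d x X) = 0 := hξ X
  -- A nonzero null vector cannot be orthogonal to the timelike `t`, whose orthogonal complement is
  -- positive definite.
  have ha : g.val (S.toFun x) t (S.d x ξ) ≠ 0 := fun h ↦ (hpos _ h (hinj hξ0)).ne' hξξ
  -- This `c` makes `X - c ξ` orthogonal to `t`. Subtracting a radical vector does not change the
  -- length, and the difference is nonzero because the screen meets the radical only in `0`.
  set c := g.val (S.toFun x) t (S.d x X) / g.val (S.toFun x) t (S.d x ξ) with hc
  have hY0 : X - c • ξ ≠ 0 := fun h ↦ hX0 <|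
    Submodule.disjoint_def.1 (S.isCompl_screen x).disjoint X hX
      (sub_eq_zero.1 h ▸ (S.rad x).smul_mem c hξ)
  have hYt : g.val (S.toFun x) t (S.d x (X - c • ξ)) = 0 := by
    simp only [map_sub, map_smul, smul_eq_mul, hc]
    field_simp
    ring
  have h := hpos _ hYt (hinj hY0)
  simp only [map_sub, map_smul, smul_eq_mul, sub_apply, smul_apply, hξξ, hξX,
    g.symm _ (S.d x X) (S.d x ξ)] at h
  rw [metric]
  linarith

end Pointwise

end NullHypersurface

/-! ### Regularity of products, differences and determinants. -/

theorem LorentzianMetric.contMDiffAt_val_along {E' : Type*} [NormedAddCommGroup E']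
    [NormedSpace ℝ E'] {H' : Type*} [TopologicalSpace H'] {J : ModelWithCorners ℝ E' H'}
    {M' : Type*} [TopologicalSpace M'] [ChartedSpace H' M'] [IsManifold J ∞ M']
    (g : LorentzianMetric J M') {E : Type*} [NormedAddCommGroup E] [NormedSpace ℝ E]
    {H : Type*} [TopologicalSpace H] {I : ModelWithCorners ℝ E H}
    {M : Type*} [TopologicalSpace M] [ChartedSpace H M]
    {f : M → M'} {V W : Π x : M, TangentSpace J (f x)} {x : M}
    (hf : ContMDiffAt I J ∞ f x)
    (hV : ContMDiffAt I J.tangent ∞ (fun y ↦ (⟨f y, V y⟩ : TangentBundle J M')) x)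
    (hW : ContMDiffAt I J.tangent ∞ (fun y ↦ (⟨f y, W y⟩ : TangentBundle J M')) x) :
    ContMDiffAt I 𝓘(ℝ, ℝ) ∞ (fun y ↦ g.val (f y) (V y) (W y)) x := by
  have h := ContMDiffAt.clm_bundle_apply₂ (F₁ := E') (F₂ := E') (F₃ := ℝ)
    (E₃ := Bundle.Trivial M' ℝ) (g.contMDiff.contMDiffAt.comp x hf) hV hW
  rw [contMDiffAt_totalSpace] at h
  simpa using h.2

/-- Needed for `Z^⊥ = Z - Z*`. A field along `f` is treated as a map into the tangent bundle of
`M'`, so the difference is taken in coordinates, where the trivialization is fibrewise linear. -/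
theorem CovariantDerivative.mdifferentiableAt_sub {E' : Type*} [NormedAddCommGroup E']
    [NormedSpace ℝ E'] {H' : Type*} [TopologicalSpace H'] {J : ModelWithCorners ℝ E' H'}
    {M' : Type*} [TopologicalSpace M'] [ChartedSpace H' M'] [IsManifold J ∞ M']
    {E : Type*} [NormedAddCommGroup E] [NormedSpace ℝ E]
    {H : Type*} [TopologicalSpace H] {I : ModelWithCorners ℝ E H}
    {M : Type*} [TopologicalSpace M] [ChartedSpace H M]
    {f : M → M'} {V W : Π x : M, TangentSpace J (f x)} {x : M}
    (hV : MDifferentiableAt I J.tangent (fun y ↦ (⟨f y, V y⟩ : TangentBundle J M')) x)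
    (hW : MDifferentiableAt I J.tangent (fun y ↦ (⟨f y, W y⟩ : TangentBundle J M')) x) :
    MDifferentiableAt I J.tangent (fun y ↦ (⟨f y, V y - W y⟩ : TangentBundle J M')) x := by
  refine (mdifferentiableAt_totalSpace _ _).2 ⟨mdifferentiableAt_base hV, ?_⟩
  refine ((mdifferentiableAt_coord hV).sub (mdifferentiableAt_coord hW)).congr_of_eventuallyEq ?_
  filter_upwards [eventually_mem_baseSet (J := J) (mdifferentiableAt_base hV).continuousAt] with y hy
  exact ((trivializationAt E' (TangentSpace J : M' → Type _) (f x)).linear ℝ hy).map_sub (V y) (W y)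

theorem ContMDiffAt.matrix_det {E : Type*} [NormedAddCommGroup E] [NormedSpace ℝ E]
    {H : Type*} [TopologicalSpace H] {I : ModelWithCorners ℝ E H}
    {M : Type*} [TopologicalSpace M] [ChartedSpace H M]
    {ι : Type*} [Fintype ι] [DecidableEq ι] {A : M → Matrix ι ι ℝ} {x : M}
    (hA : ∀ i j, ContMDiffAt I 𝓘(ℝ, ℝ) ∞ (fun y ↦ A y i j) x) :
    ContMDiffAt I 𝓘(ℝ, ℝ) ∞ (fun y ↦ (A y).det) x := by
  simp only [Matrix.det_apply']
  exact contMDiffAt_finsetSum fun σ _ ↦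
    contMDiffAt_const.mul (contMDiffAt_finsetProd fun i _ ↦ hA _ _)

/-! ### Smoothness of the screen component and of its normalization. -/

namespace NullHypersurface

variable {n : ℕ} {M' : Type*} [TopologicalSpace M']
    [ChartedSpace (EuclideanSpace ℝ (Fin (n + 2))) M'] [IsManifold (𝓡 (n + 2)) ∞ M']
    {g : LorentzianMetric (𝓡 (n + 2)) M'} {M : Type*} [TopologicalSpace M]
    [ChartedSpace (EuclideanSpace ℝ (Fin (n + 1))) M] [IsManifold (𝓡 (n + 1)) ∞ M]
    (S : NullHypersurface g M) {x : M}

theorem contMDiffAt_d {Y : Π x : M, TangentSpace (𝓡 (n + 1)) x}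
    (hY : ContMDiffAt (𝓡 (n + 1)) (𝓡 (n + 1)).tangent ∞
      (fun y ↦ (⟨y, Y y⟩ : TangentBundle (𝓡 (n + 1)) M)) x) :
    ContMDiffAt (𝓡 (n + 1)) (𝓡 (n + 2)).tangent ∞
      (fun y ↦ (⟨S.toFun y, S.d y (Y y)⟩ : TangentBundle (𝓡 (n + 2)) M')) x :=
  (S.contMDiff_toFun.contMDiff_tangentMap (m := ∞) (by simp)).contMDiffAt.comp x hY

theorem mdifferentiableAt_d {Y : Π x : M, TangentSpace (𝓡 (n + 1)) x}
    (hY : ContMDiffAt (𝓡 (n + 1)) (𝓡 (n + 1)).tangent ∞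
      (fun y ↦ (⟨y, Y y⟩ : TangentBundle (𝓡 (n + 1)) M)) x) :
    MDifferentiableAt (𝓡 (n + 1)) (𝓡 (n + 2)).tangent
      (fun y ↦ (⟨S.toFun y, S.d y (Y y)⟩ : TangentBundle (𝓡 (n + 2)) M')) x :=
  (S.contMDiffAt_d hY).mdifferentiableAt (by simp)

theorem contMDiffAt_metric {X Y : Π x : M, TangentSpace (𝓡 (n + 1)) x}
    (hX : ContMDiffAt (𝓡 (n + 1)) (𝓡 (n + 1)).tangent ∞
      (fun y ↦ (⟨y, X y⟩ : TangentBundle (𝓡 (n + 1)) M)) x)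
    (hY : ContMDiffAt (𝓡 (n + 1)) (𝓡 (n + 1)).tangent ∞
      (fun y ↦ (⟨y, Y y⟩ : TangentBundle (𝓡 (n + 1)) M)) x) :
    ContMDiffAt (𝓡 (n + 1)) 𝓘(ℝ, ℝ) ∞ (fun y ↦ S.metric y (X y) (Y y)) x :=
  g.contMDiffAt_val_along S.contMDiff_toFun.contMDiffAt (S.contMDiffAt_d hX) (S.contMDiffAt_d hY)

theorem star_mem (Z : Π x : M, TangentSpace (𝓡 (n + 2)) (S.toFun x)) (x : M) :
    S.star Z x ∈ S.screen x :=
  S.screenProj_mem _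

theorem metric_sum_smul_left {ι : Type*} (t : Finset ι) (c : ι → ℝ)
    (s : ι → TangentSpace (𝓡 (n + 1)) x) (w : TangentSpace (𝓡 (n + 1)) x) :
    S.metric x (∑ i ∈ t, c i • s i) w = ∑ i ∈ t, c i * S.metric x (s i) w := by
  simp [metric]

theorem metric_symm (v w : TangentSpace (𝓡 (n + 1)) x) : S.metric x v w = S.metric x w v :=
  g.symm _ _ _

/-- The Gram matrix of a family of tangent vectors. -/
def gram {ι : Type*} (x : M) (s : ι → TangentSpace (𝓡 (n + 1)) x) : Matrix ι ι ℝ :=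
  fun i j ↦ S.metric x (s i) (s j)

/-- Makes the coefficients of a vector in the family a solution of a linear system whose right-hand
side consists of its inner products with the family. -/
theorem gram_mulVec {ι : Type*} [Fintype ι] (s : ι → TangentSpace (𝓡 (n + 1)) x) (c : ι → ℝ)
    (i : ι) : (S.gram x s).mulVec c i = S.metric x (∑ j, c j • s j) (s i) := by
  rw [metric_sum_smul_left]
  refine Finset.sum_congr rfl fun j _ ↦ ?_
  change S.metric x (s i) (s j) * c j = _
  rw [metric_symm, mul_comm]

/-- A kernel vector of the Gram matrix would give a nonzero screen vector orthogonal to every `s i`,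
hence to itself, against positivity on the screen. -/
theorem det_gram_ne_zero {ι : Type*} [Fintype ι] [DecidableEq ι]
    {s : ι → TangentSpace (𝓡 (n + 1)) x} (hs : LinearIndependent ℝ s)
    (hsS : ∀ i, s i ∈ S.screen x) : (S.gram x s).det ≠ 0 := by
  intro h
  obtain ⟨c, hc0, hc⟩ := Matrix.exists_mulVec_eq_zero_iff.2 h
  have hne : ∑ j, c j • s j ≠ 0 := fun h0 ↦
    hc0 (funext (Fintype.linearIndependent_iff.1 hs c h0))
  refine (S.metric_self_pos ((S.screen x).sum_mem fun j _ ↦ (S.screen x).smul_mem _ (hsS j))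
    hne).ne' ?_
  rw [metric_sum_smul_left]
  refine Finset.sum_eq_zero fun i _ ↦ ?_
  rw [metric_symm, ← gram_mulVec, hc, Pi.zero_apply, mul_zero]

/-- Cramer's formula for the screen component in a frame of the screen distribution. -/
theorem screenProj_tangentProj_eq_sum {ι : Type*} [Fintype ι] [DecidableEq ι]
    {s : ι → TangentSpace (𝓡 (n + 1)) x} (hs : LinearIndependent ℝ s)
    (hsS : Submodule.span ℝ (Set.range s) = S.screen x)
    (w : TangentSpace (𝓡 (n + 2)) (S.toFun x)) :
    S.screenProj x (S.tangentProj x w) = ∑ i, ((S.gram x s).det⁻¹ *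
      (S.gram x s).cramer (fun i ↦ g.val (S.toFun x) w (S.d x (s i))) i) • s i := by
  have hmem (i : ι) : s i ∈ S.screen x := hsS ▸ Submodule.subset_span ⟨i, rfl⟩
  obtain ⟨c, hc⟩ := (Submodule.mem_span_range_iff_exists_fun ℝ).1
    (hsS.symm ▸ S.screenProj_mem (S.tangentProj x w) :
      S.screenProj x (S.tangentProj x w) ∈ Submodule.span ℝ (Set.range s))
  -- The right-hand side involves only `w`, not its projections, because `w` and its screen
  -- component have the same products with the screen. This is what makes the coefficients visibly
  -- smooth.
  have h : (S.gram x s).mulVec c = fun i ↦ g.val (S.toFun x) w (S.d x (s i)) := by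
    ext i
    rw [gram_mulVec, hc, S.metric_screenProj_tangentProj w (hmem i)]
  rw [← hc, ← h]
  refine Finset.sum_congr rfl fun i _ ↦ ?_
  rw [Matrix.cramer_eq_adjugate_mulVec, Matrix.mulVec_mulVec, Matrix.adjugate_mul,
    Matrix.smul_mulVec, Matrix.one_mulVec, Pi.smul_apply, smul_eq_mul,
    inv_mul_cancel_left₀ (S.det_gram_ne_zero hs hmem)]

/-- The screen component of a smooth vector field along `M` is smooth. -/
theorem contMDiff_star {Z : Π x : M, TangentSpace (𝓡 (n + 2)) (S.toFun x)}
    (hZ : ContMDiff (𝓡 (n + 1)) (𝓡 (n + 2)).tangent ∞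
      (fun x ↦ (⟨S.toFun x, Z x⟩ : TangentBundle (𝓡 (n + 2)) M'))) :
    ContMDiff (𝓡 (n + 1)) (𝓡 (n + 1)).tangent ∞
      (fun x ↦ (⟨x, S.star Z x⟩ : TangentBundle (𝓡 (n + 1)) M)) := by
  intro x
  obtain ⟨U, s, hU, hxU, hs, hframe⟩ := S.exists_frame x
  have hs' (i) : ContMDiffAt (𝓡 (n + 1)) (𝓡 (n + 1)).tangent ∞
      (fun y ↦ (⟨y, s i y⟩ : TangentBundle (𝓡 (n + 1)) M)) x :=
    (hs i).contMDiffAt (hU.mem_nhds hxU)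
  have hG (i j) : ContMDiffAt (𝓡 (n + 1)) 𝓘(ℝ, ℝ) ∞ (fun y ↦ S.gram y (fun i ↦ s i y) i j) x :=
    S.contMDiffAt_metric (hs' i) (hs' j)
  have hb (i) : ContMDiffAt (𝓡 (n + 1)) 𝓘(ℝ, ℝ) ∞
      (fun y ↦ g.val (S.toFun y) (Z y) (S.d y (s i y))) x :=
    g.contMDiffAt_val_along S.contMDiff_toFun.contMDiffAt hZ.contMDiffAt (S.contMDiffAt_d (hs' i))
  have hmem : ∀ i, s i x ∈ S.screen x := fun i ↦
    (hframe x hxU).2 ▸ Submodule.subset_span ⟨i, rfl⟩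
  have hc (i) : ContMDiffAt (𝓡 (n + 1)) 𝓘(ℝ, ℝ) ∞
      (fun y ↦ (S.gram y (fun i ↦ s i y)).det⁻¹ * (S.gram y (fun i ↦ s i y)).cramer
        (fun i ↦ g.val (S.toFun y) (Z y) (S.d y (s i y))) i) x := by
    refine ((ContMDiffAt.matrix_det hG).inv₀ (S.det_gram_ne_zero (hframe x hxU).1 hmem)).mul ?_
    simp only [Matrix.cramer_apply]
    -- Each Cramer numerator is the determinant of the Gram matrix with column `i` replaced by the
    -- products of `Z` with the frame.
    refine ContMDiffAt.matrix_det fun j k ↦ ?_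
    by_cases hk : k = i
    · subst hk
      simpa using hb j
    · simpa [Matrix.updateCol_ne hk] using hG j k
  refine (ContMDiffAt.sum_section (s := Finset.univ)
    fun i _ ↦ (hc i).smul_section (hs' i)).congr_of_eventuallyEq ?_
  filter_upwards [hU.mem_nhds hxU] with y hy
  rw [star, S.screenProj_tangentProj_eq_sum (hframe y hy).1 (hframe y hy).2 (Z y)]
  rfl

/-- The square root is smooth away from `0`, and `|Z*|²` is positive since `Z*` is a nonzero screen
vector. The factor `|Z*|⁻¹` is kept as a separate conclusion because the Leibniz rule for `T`
differentiates it. -/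
theorem contMDiff_unitStar {Z : Π x : M, TangentSpace (𝓡 (n + 2)) (S.toFun x)}
    (hZ : ContMDiff (𝓡 (n + 1)) (𝓡 (n + 2)).tangent ∞
      (fun x ↦ (⟨S.toFun x, Z x⟩ : TangentBundle (𝓡 (n + 2)) M')))
    (hZ0 : ∀ x, S.star Z x ≠ 0) :
    ContMDiff (𝓡 (n + 1)) 𝓘(ℝ, ℝ) ∞ (fun x ↦ (√(S.metric x (S.star Z x) (S.star Z x)))⁻¹) ∧
      ContMDiff (𝓡 (n + 1)) (𝓡 (n + 1)).tangent ∞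
        (fun x ↦ (⟨x, S.unitStar Z x⟩ : TangentBundle (𝓡 (n + 1)) M)) := by
  have h := S.contMDiff_star hZ
  have hpos (x) := S.metric_self_pos (S.star_mem Z x) (hZ0 x)
  have ha : ContMDiff (𝓡 (n + 1)) 𝓘(ℝ, ℝ) ∞
      (fun x ↦ (√(S.metric x (S.star Z x) (S.star Z x)))⁻¹) := fun x ↦
    ContMDiffAt.inv₀ ((Real.contDiffAt_sqrt (hpos x).ne').contMDiffAt.comp x
      (S.contMDiffAt_metric (h x) (h x))) (Real.sqrt_pos.2 (hpos x)).ne'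
  exact ⟨ha, ha.smul_section h⟩

theorem metric_unitStar {Z : Π x : M, TangentSpace (𝓡 (n + 2)) (S.toFun x)}
    (hZ0 : S.star Z x ≠ 0) : S.metric x (S.unitStar Z x) (S.unitStar Z x) = 1 := by
  have hpos := S.metric_self_pos (S.star_mem Z x) hZ0
  have h := Real.sq_sqrt hpos.le
  have h0 := (Real.sqrt_pos.2 hpos).ne'
  have : S.metric x (S.unitStar Z x) (S.unitStar Z x) =
      (√(S.metric x (S.star Z x) (S.star Z x)))⁻¹ ^ 2 * S.metric x (S.star Z x) (S.star Z x) := by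
    rw [unitStar, metric]
    simp only [map_smul, smul_apply, smul_eq_mul]
    rw [metric]
    ring
  rw [this, inv_pow, h, inv_mul_cancel₀ hpos.ne']

/-! ### Identities for the screen connection and the shape operator. -/

/-- For a section `Y` of the screen of constant length, `∇*_v Y` is orthogonal to `Y`. -/
theorem metric_screenConn_self {Y : Π x : M, TangentSpace (𝓡 (n + 1)) x}
    (hY : ContMDiff (𝓡 (n + 1)) (𝓡 (n + 1)).tangent ∞
      (fun x ↦ (⟨x, Y x⟩ : TangentBundle (𝓡 (n + 1)) M)))
    (hYS : ∀ x, Y x ∈ S.screen x) {c : ℝ} (hc : ∀ x, S.metric x (Y x) (Y x) = c)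
    (v : TangentSpace (𝓡 (n + 1)) x) : S.metric x (S.screenConn Y x v) (Y x) = 0 := by
  have hd := S.mdifferentiableAt_d (hY x)
  -- The derivative of the constant `g(Y, Y)` is `2 g(∇_v Y, Y)`, and passing to the screen
  -- component of `∇_v Y` leaves the product with `Y` unchanged.
  have h := g.mvfderiv_val_along hd hd v
  have hcst : (fun y ↦ g.val (S.toFun y) (S.d y (Y y)) (S.d y (Y y))) = fun _ ↦ c := funext hc
  rw [hcst, mvfderiv_const, g.symm _ (S.d x (Y x)), zero_apply] at h
  refine (S.metric_screenProj_tangentProj _ (hYS x)).trans ?_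
  change g.val (S.toFun x)
    (g.leviCivita.along (𝓡 (n + 1)) (fun y ↦ S.d y (Y y)) x v) (S.d x (Y x)) = 0
  linarith

/-- The Leibniz rule survives both projections because they fix the screen vector `Y x` in the term
carrying the derivative of `a`. -/
theorem screenConn_smul {Y : Π x : M, TangentSpace (𝓡 (n + 1)) x}
    (hY : ContMDiff (𝓡 (n + 1)) (𝓡 (n + 1)).tangent ∞
      (fun x ↦ (⟨x, Y x⟩ : TangentBundle (𝓡 (n + 1)) M)))
    (hYS : ∀ x, Y x ∈ S.screen x) {a : M → ℝ} (ha : ContMDiff (𝓡 (n + 1)) 𝓘(ℝ, ℝ) ∞ a)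
    (v : TangentSpace (𝓡 (n + 1)) x) :
    S.screenConn (fun y ↦ a y • Y y) x v =
      a x • S.screenConn Y x v + mvfderiv (𝓡 (n + 1)) a x v • Y x := by
  have h := g.leviCivita.along_smul (ha.mdifferentiableAt (x := x) (by simp))
    (S.mdifferentiableAt_d (hY x))
  have h' := congrArg (fun L ↦ S.screenProj x (S.tangentProj x (L v))) h
  simp only [add_apply, smul_apply, ContinuousLinearMap.smulRight_apply, map_add, map_smul,
    S.tangentProj_d, S.screenProj_of_mem (hYS x)] at h'
  simp only [screenConn, inducedConn, ambientConn, LinearMap.comp_apply, map_smul]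
  exact h'

/-- The screen component of the equation `∇_v Z = φ v` for `v` in the screen. -/
theorem IsClosedConformal.shape_perp {Z : Π x : M, TangentSpace (𝓡 (n + 2)) (S.toFun x)}
    {φ : M → ℝ} (hZ : S.IsClosedConformal Z φ) {v : TangentSpace (𝓡 (n + 1)) x}
    (hv : v ∈ S.screen x) :
    S.shape (S.perp Z) x v = S.screenConn (S.star Z) x v - φ x • v := by
  have hd := S.mdifferentiableAt_d (S.contMDiff_star hZ.contMDiff x)
  have hperp : MDifferentiableAt (𝓡 (n + 1)) (𝓡 (n + 2)).tangent
      (fun y ↦ (⟨S.toFun y, S.perp Z y⟩ : TangentBundle (𝓡 (n + 2)) M')) x :=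
    CovariantDerivative.mdifferentiableAt_sub (hZ.contMDiff.mdifferentiableAt (by simp)) hd
  have h := g.leviCivita.along_add hperp hd
  have hZ' : (fun y ↦ S.perp Z y + S.d y (S.star Z y)) = Z :=
    funext fun y ↦ sub_add_cancel _ _
  rw [hZ'] at h
  have h' := congrArg (fun L ↦ S.screenProj x (S.tangentProj x (L v))) h
  -- As `v` lies in the screen, projecting `φ v` loses nothing.
  have hφ := congrArg (fun w ↦ S.screenProj x (S.tangentProj x w)) (hZ.conn_eq x v)
  simp only [map_smul, S.tangentProj_d, S.screenProj_of_mem hv] at hφ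
  simp only [add_apply, map_add] at h'
  have h₁ : φ x • v = -S.shape (S.perp Z) x v + S.screenConn (S.star Z) x v := by
    rw [← hφ, shape, LinearMap.neg_apply, neg_neg]
    exact h'
  rw [h₁]
  abel

end NullHypersurface

end

/-! ### The geodesic equation and the eigenvalue. -/

theorem mainTheorem7 {n : ℕ} {M' : Type*} [TopologicalSpace M']
    [ChartedSpace (EuclideanSpace ℝ (Fin (n + 2))) M'] [IsManifold (𝓡 (n + 2)) ∞ M']
    (g : LorentzianMetric (𝓡 (n + 2)) M') {M : Type*} [TopologicalSpace M]
    [ChartedSpace (EuclideanSpace ℝ (Fin (n + 1))) M] [IsManifold (𝓡 (n + 1)) ∞ M]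
    (S : NullHypersurface g M) (hS : S.ScreenIntegrable)
    (Z : (x : M) → TangentSpace (𝓡 (n + 2)) (S.toFun x)) (φ : M → ℝ)
    (hZ : S.IsClosedConformal Z φ) (hA : S.HasCanonicalPrincipalDirection Z) :
    S.IsScreenGeodesic (S.unitStar Z) ∧
      ∀ (x : M) (k : ℝ), (S.shape (S.perp Z) x).HasEigenvector k (S.unitStar Z x) ↔
        k = S.metric x (S.screenConn (S.star Z) x (S.unitStar Z x)) (S.unitStar Z x) - φ x := by
  obtain ⟨κ, hκ⟩ := hA
  have hZ0 (x) : S.star Z x ≠ 0 := (hκ x).2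
  obtain ⟨ha, hT⟩ := S.contMDiff_unitStar hZ.contMDiff hZ0
  have hTS (x) : S.unitStar Z x ∈ S.screen x := (S.screen x).smul_mem _ (S.star_mem Z x)
  have hT1 (x) := S.metric_unitStar (hZ0 x)
  have hT0 (x) : S.unitStar Z x ≠ 0 := fun h ↦ by simpa [h, NullHypersurface.metric] using hT1 x
  have hshape (x) : S.shape (S.perp Z) x (S.unitStar Z x) = κ x • S.unitStar Z x := by
    rw [NullHypersurface.unitStar, map_smul, (hκ x).apply_eq_smul, smul_comm]
  have hconn (x) : S.screenConn (S.star Z) x (S.unitStar Z x) = (κ x + φ x) • S.unitStar Z x := by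
    have h := hZ.shape_perp S (hTS x)
    rw [hshape] at h
    rw [add_smul, h, sub_add_cancel]
  refine ⟨⟨hTS, hT, fun x ↦ ?_⟩, fun x k ↦ ?_⟩
  -- Both Leibniz terms of `∇*_T(|Z*|⁻¹ Z*)` are multiples of `Z*`: the first because `∇*_T Z*` is a
  -- multiple of `T`, the second by its form.
  · obtain ⟨c, hc⟩ : ∃ c : ℝ, S.screenConn (S.unitStar Z) x (S.unitStar Z x) =
        c • S.star Z x := by
      have h := S.screenConn_smul (S.contMDiff_star hZ.contMDiff) (S.star_mem Z) ha
        (S.unitStar Z x)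
      rw [hconn x] at h
      rw [NullHypersurface.unitStar, smul_smul, smul_smul, ← add_smul] at h
      exact ⟨_, h⟩
    have h0 := S.metric_screenConn_self hT hTS hT1 (S.unitStar Z x)
    have hpos := S.metric_self_pos (S.star_mem Z x) (hZ0 x)
    rw [hc] at h0 ⊢
    -- Orthogonality to `T` says `c g(Z*, T) = 0`, and `g(Z*, T) = |Z*|⁻¹ |Z*|²` is positive.
    have h0' : c * ((√(S.metric x (S.star Z x) (S.star Z x)))⁻¹ *
        S.metric x (S.star Z x) (S.star Z x)) = 0 := by
      rw [← h0, NullHypersurface.unitStar]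
      simp only [NullHypersurface.metric, map_smul, smul_apply, smul_eq_mul]
      ring
    have hc0 : c = 0 := (mul_eq_zero.1 h0').resolve_right
      (mul_pos (inv_pos.2 (Real.sqrt_pos.2 hpos)) hpos).ne'
    rw [hc0, zero_smul]
  · have hk : S.metric x (S.screenConn (S.star Z) x (S.unitStar Z x)) (S.unitStar Z x) - φ x =
        κ x := by
      have h1 := hT1 x
      rw [hconn]
      simp only [NullHypersurface.metric, map_smul, smul_apply, smul_eq_mul] at h1 ⊢
      rw [h1]
      ring
    rw [hk]
    refine ⟨fun h ↦ ?_, fun h ↦ ?_⟩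
    -- A nonzero vector has at most one eigenvalue, so `k` must be `κ x`.
    · exact smul_left_injective ℝ (hT0 x) (h.apply_eq_smul.symm.trans (hshape x))
    · subst h
      exact ⟨Module.End.mem_eigenspace_iff.2 (hshape x), hT0 x⟩
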